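/- Let $\mathbf{T}$ be an essentially small site with enough points. A simplicial presheaf on $\mathbf{T}$ is a functor from $\mathbf{T}^{\mathrm{op}}$ to the category $\mathbf{sS}$ of simplicial sets. Equip $\mathbf{sS}$ with its standard (Kan–Quillen) model structure, in which the cofibrations are the monomorphisms and the fibrations are the Kan fibrations. A map $\mathcal{F} \to \mathcal{G}$ of simplicial presheaves is called a projective fibration if $\mathcal{F}(U) \to \mathcal{G}(U)$ is a Kan fibration for every object $U$ of $\mathbf{T}$, and a local weak equivalence if the induced map of stalks $\mathcal{F}_x \to \mathcal{G}_x$ is a weak equivalence of simplicial sets for every point $x$ of $\mathbf{T}$. Let $f \colon \mathcal{X} \to \mathcal{Z}$ be a projective fibration and let $g \colon \mathcal{Y} \to \mathcal{Z}$ be a local weak equivalence of simplicial presheaves on $\mathbf{T}$. Then the induced map $f' \colon \mathcal{X} \times_{\mathcal{Z}} \mathcal{Y} \to \mathcal{X}$ is a local weak equivalence as well. -/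

import Mathlib

open CategoryTheory HomotopicalAlgebra

universe w v u

namespace SimplicialPresheaf

section SimplicialSets

open scoped SSet.modelCategoryQuillen

/-- Kan fibrations of simplicial sets: the morphisms with the right lifting property with
respect to all horn inclusions `Λ[n, k] ⟶ Δ[n]`, `n ≥ 1`, `0 ≤ k ≤ n`. -/
def kanFibrations : MorphismProperty SSet.{w} :=
  fibrations SSet.{w}

/-- Weak equivalences of the standard (Kan-Quillen) model structure on simplicial sets, whose
cofibrations are the monomorphisms and whose fibrations are the Kan fibrations.

The cofibrations and the fibrations of a model structure determine its weak equivalences: the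
acyclic cofibrations are the morphisms with the left lifting property with respect to all
fibrations, the acyclic fibrations are the morphisms with the right lifting property with respect
to all cofibrations, and a morphism is a weak equivalence if and only if it is an acyclic
cofibration followed by an acyclic fibration. See `weakEquivalences_eq_kanQuillen` below. -/
def kanQuillenWeakEquivalences : MorphismProperty SSet.{w} :=
  fun X Y f => ∃ (E : SSet.{w}) (i : X ⟶ E) (p : E ⟶ Y),
    (fibrations SSet.{w}).llp i ∧ (cofibrations SSet.{w}).rlp p ∧ i ≫ p = f

end SimplicialSets

/-- A model structure on simplicial sets whose cofibrations are the monomorphisms and whose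
fibrations are the Kan fibrations has exactly the weak equivalences defined above. -/
theorem weakEquivalences_eq_kanQuillen (M : ModelCategory SSet.{w})
    (hcof : @cofibrations SSet.{w} _ M.categoryWithCofibrations =
      MorphismProperty.monomorphisms SSet.{w})
    (hfib : @fibrations SSet.{w} _ M.categoryWithFibrations = kanFibrations.{w}) :
    @weakEquivalences SSet.{w} _ M.categoryWithWeakEquivalences =
      kanQuillenWeakEquivalences.{w} := by
  have hllp := fibrations_llp SSet.{w}
  have hrlp := cofibrations_rlp SSet.{w}
  rw [hfib] at hllp
  rw [hcof] at hrlp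
  ext X Y f
  constructor
  · intro hf
    let d := MorphismProperty.factorizationData (trivialCofibrations SSet.{w})
      (fibrations SSet.{w}) f
    refine ⟨d.Z, d.i, d.p, ?_, ?_, d.fac⟩
    · change kanFibrations.{w}.llp d.i
      rw [hllp]
      exact d.hi
    · change (MorphismProperty.monomorphisms SSet.{w}).rlp d.p
      rw [hrlp]
      refine ⟨d.hp, ?_⟩
      exact MorphismProperty.of_precomp _ d.i d.p d.hi.2 (by rw [d.fac]; exact hf)
  · rintro ⟨E, i, p, hi, hp, rfl⟩
    change kanFibrations.{w}.llp i at hi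
    change (MorphismProperty.monomorphisms SSet.{w}).rlp p at hp
    rw [hllp] at hi
    rw [hrlp] at hp
    exact MorphismProperty.comp_mem _ _ _ hi.2 hp.2

/-- Projective fibrations of simplicial presheaves: the objectwise Kan fibrations. -/
def projectiveFibrations (C : Type u) [Category.{v} C] :
    MorphismProperty (Cᵒᵖ ⥤ SSet.{w}) :=
  fun _ _ f => ∀ U : Cᵒᵖ, kanFibrations (f.app U)

/-- Local weak equivalences of simplicial presheaves on a site with enough points: the morphisms
which induce a weak equivalence of simplicial sets on the stalks at every point of the site. -/
def localWeakEquivalences {C : Type u} [Category.{v} C] (J : GrothendieckTopology C) :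
    MorphismProperty (Cᵒᵖ ⥤ SSet.{w}) :=
  fun _ _ f => ∀ x : GrothendieckTopology.Point.{w} J,
    kanQuillenWeakEquivalences (x.presheafFiber.map f)

end SimplicialPresheaf

/-! Stalks are filtered colimits, so they commute with pullbacks; since horns and simplices are
finitely presentable, they also turn objectwise Kan fibrations into Kan fibrations. What remains is
right properness of simplicial sets.

A weak equivalence is an anodyne map followed by a map with the right lifting property against
monomorphisms. The latter are stable under base change, so it suffices that anodyne maps are stable
under pullback along a Kan fibration `p` (`anodyneExtensions.of_isPullback`). Pullback along `p` has
a right adjoint, the dependent product, and by adjunction it is enough that this adjoint preserves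
fibrations. That in turn only involves horn inclusions pulled back along fibrations over a simplex
(`anodyneExtensions_preimage_horn_ι`). These are anodyne because a simplex deforms into its horn,
and the deformation lifts along the fibration. -/

namespace SSet

/-! ### Preimages of horns under Kan fibrations -/

open Simplicial MonoidalCategory CartesianMonoidalCategory Opposite
open scoped modelCategoryQuillen

/-- The inclusion `X ⟶ X ⊗ Δ[1]` of the cylinder's end at the vertex `k`. -/
noncomputable def cylinderEnd (k : Fin 2) (X : SSet.{u}) : X ⟶ X ⊗ Δ[1] :=
  lift (𝟙 X) (const (stdSimplex.obj₀Equiv.{u}.symm k))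

lemma cylinderEnd_comp (k : Fin 2) {X Y : SSet.{u}} (f : X ⟶ Y) :
    cylinderEnd k X ≫ f ▷ _ = f ≫ cylinderEnd k Y := rfl

lemma cylinderEnd_app_snd (k : Fin 2) {X : SSet.{u}} {m : ℕ} (x : X _⦋m⦌) (j : Fin (m + 1)) :
    DFunLike.coe (F := Δ[1] _⦋m⦌) (((cylinderEnd k X).app (op ⦋m⦌) x).2) j = k := rfl

lemma mem_horn_one_iff (k : Fin 2) {m : ℕ} (t : (Δ[1] : SSet.{u}) _⦋m⦌) :
    t ∈ (horn.{u} 1 k).obj (op ⦋m⦌) ↔ ∀ j, t j = k := by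
  rw [mem_horn_iff_notMem_range]
  constructor
  · rintro ⟨l, hl, h⟩ j
    have : t j ≠ l := fun h' ↦ h ⟨j, h'⟩
    lia
  · intro h
    refine ⟨k.rev, by fin_cases k <;> decide, ?_⟩
    rintro ⟨j, hj⟩
    rw [h j] at hj
    fin_cases k <;> simp at hj

lemma anodyneExtensions_of_range_eq {X Y : SSet.{u}} (f : X ⟶ Y) [Mono f] {A : Y.Subcomplex}
    (h : Subcomplex.range f = A) (hA : anodyneExtensions A.ι) : anodyneExtensions f := by
  subst h
  rw [← Subfunctor.toRange_ι f]
  exact MorphismProperty.comp_mem _ _ _ (.of_isIso _) hA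

instance (k : Fin 2) (X : SSet.{u}) : Mono (cylinderEnd k X) :=
  (SplitMono.mk (fst _ _) rfl : SplitMono (cylinderEnd k X)).mono

lemma Subcomplex.mk_mem_unionProd_iff {X Y : SSet.{u}} {S : X.Subcomplex} {T : Y.Subcomplex}
    {m : SimplexCategoryᵒᵖ} {x : X.obj m} {y : Y.obj m} :
    (x, y) ∈ (S.unionProd T).obj m ↔ y ∈ T.obj m ∨ x ∈ S.obj m :=
  Subcomplex.mem_unionProd_iff S T (x, y)

/-- Up to isomorphism this is the pushout-product of `∅ ⟶ X` with the horn `Λ[1, k] ⟶ Δ[1]`, which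
is the vertex `k`. -/
lemma anodyneExtensions_cylinderEnd (k : Fin 2) (X : SSet.{u}) :
    anodyneExtensions (cylinderEnd k X) := by
  refine anodyneExtensions_of_range_eq _ ?_
    (anodyneExtensions_unionProd_ι (⊥ : X.Subcomplex) _ (.horn_ι (n := 1) k))
  ext ⟨⟨m⟩⟩ ⟨x, t⟩
  refine Iff.trans ?_ Subcomplex.mk_mem_unionProd_iff.symm
  constructor
  · rintro ⟨y, hy⟩
    have h : t = ((cylinderEnd k X).app _ y).2 := by rw [hy]
    subst h
    exact Or.inl ((mem_horn_one_iff _ _).2 (cylinderEnd_app_snd k y))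
  · rintro (h | h)
    · refine ⟨x, Prod.ext rfl (stdSimplex.ext _ _ fun j ↦ ?_)⟩
      exact ((mem_horn_one_iff _ _).1 h j).symm
    · exact h.elim

/-- A subcomplex `A` of `X` is deformation absorbing if there is a homotopy `X ⊗ Δ[1] ⟶ X`
between the identity and an endomorphism with values in `A` which preserves `A`. -/
def Subcomplex.IsAbsorbing {X : SSet.{u}} (A : X.Subcomplex) (k : Fin 2) : Prop :=
  ∃ (H : X ⊗ Δ[1] ⟶ X), cylinderEnd k.rev X ≫ H = 𝟙 X ∧
    A.unionProd (horn 1 k) ≤ A.preimage H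

/-- The end `k.rev` of the cylinder and the homotopy `H` exhibit `A ⟶ X` as a retract of the
pushout-product `A ⊗ Δ[1] ∪ X ⊗ Λ[1, k] ⟶ X ⊗ Δ[1]`. -/
lemma Subcomplex.IsAbsorbing.anodyneExtensions {X : SSet.{u}} {A : X.Subcomplex} {k : Fin 2}
    (hA : A.IsAbsorbing k) : anodyneExtensions A.ι := by
  obtain ⟨H, h₁, h₂⟩ := hA
  let r : RetractArrow A.ι (A.unionProd (horn 1 k)).ι :=
    { i := Arrow.homMk (Subcomplex.lift (A.ι ≫ cylinderEnd k.rev X) (by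
          rintro m _ ⟨a, rfl⟩
          exact Or.inr ⟨a.2, Set.mem_univ _⟩)) (cylinderEnd k.rev X) rfl
      r := Arrow.homMk (Subcomplex.lift ((A.unionProd (horn 1 k)).ι ≫ H) (by
          rintro m _ ⟨a, rfl⟩
          exact h₂ _ a.2)) H rfl
      retract := by
        ext : 1
        · rw [← cancel_mono A.ι]
          exact (congr_arg (A.ι ≫ ·) h₁).trans (Category.comp_id _)
        · exact h₁ }
  exact MorphismProperty.of_retract r
    (anodyneExtensions_unionProd_ι A _ (.horn_ι (n := 1) k))

/-- The homotopy on `B`, precomposed with `p`, lifts to `E` starting from the identity, since the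
cylinder end is anodyne. -/
lemma Subcomplex.IsAbsorbing.preimage {E B : SSet.{u}} {A : B.Subcomplex} {k : Fin 2}
    (hA : A.IsAbsorbing k) (p : E ⟶ B) [Fibration p] : (A.preimage p).IsAbsorbing k := by
  obtain ⟨H, h₁, h₂⟩ := hA
  have := anodyneExtensions_cylinderEnd k.rev E p (by rwa [← fibration_iff])
  have sq : CommSq (𝟙 E) (cylinderEnd k.rev E) p (p ▷ _ ≫ H) :=
    ⟨by rw [← Category.assoc, cylinderEnd_comp, Category.assoc, h₁]; simp⟩
  refine ⟨sq.lift, sq.fac_left, ?_⟩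
  rw [← Subcomplex.preimage_comp, sq.fac_right]
  rintro m ⟨e, t⟩ h
  exact h₂ _ (mk_mem_unionProd_iff.2 (mk_mem_unionProd_iff.1 h))

/-- The homotopy `Δ[n] ⊗ Δ[1] ⟶ Δ[n]` between two comparable order-preserving maps. -/
def stdSimplexHomotopy {n : ℕ} (f g : Fin (n + 1) →o Fin (n + 1)) (h : f ≤ g) :
    (Δ[n] ⊗ Δ[1] : SSet.{u}) ⟶ Δ[n] where
  app m := ↾fun x ↦ stdSimplex.objMk
    ⟨fun j ↦ if stdSimplex.asOrderHom x.2 j = 0 then f (stdSimplex.asOrderHom x.1 j)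
      else g (stdSimplex.asOrderHom x.1 j), fun i j hij ↦ by
        have h₁ := (stdSimplex.asOrderHom x.1).monotone hij
        have h₂ := (stdSimplex.asOrderHom x.2).monotone hij
        dsimp only
        split_ifs with hi hj hj
        · exact f.monotone h₁
        · exact (f.monotone h₁).trans (h _)
        · exfalso; rw [hj] at h₂; exact hi (le_antisymm h₂ (Fin.zero_le _))
        · exact g.monotone h₁⟩
  naturality _ _ _ := rfl

lemma stdSimplexHomotopy_app_apply {n : ℕ} (f g : Fin (n + 1) →o Fin (n + 1)) (h : f ≤ g)
    {m : ℕ} (x : (Δ[n] : SSet.{u}) _⦋m⦌) (t : (Δ[1] : SSet.{u}) _⦋m⦌) (j : Fin (m + 1)) :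
    DFunLike.coe (F := Δ[n] _⦋m⦌) ((stdSimplexHomotopy f g h).app (op ⦋m⦌) (x, t)) j =
      if t j = 0 then f (x j) else g (x j) := rfl

lemma cylinderEnd_zero_stdSimplexHomotopy_app_apply {n : ℕ} (f g : Fin (n + 1) →o Fin (n + 1))
    (h : f ≤ g) {m : ℕ} (x : (Δ[n] : SSet.{u}) _⦋m⦌) (j : Fin (m + 1)) :
    DFunLike.coe (F := Δ[n] _⦋m⦌)
      ((cylinderEnd 0 _ ≫ stdSimplexHomotopy f g h).app (op ⦋m⦌) x) j = f (x j) := rfl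

lemma cylinderEnd_one_stdSimplexHomotopy_app_apply {n : ℕ} (f g : Fin (n + 1) →o Fin (n + 1))
    (h : f ≤ g) {m : ℕ} (x : (Δ[n] : SSet.{u}) _⦋m⦌) (j : Fin (m + 1)) :
    DFunLike.coe (F := Δ[n] _⦋m⦌)
      ((cylinderEnd 1 _ ≫ stdSimplexHomotopy f g h).app (op ⦋m⦌) x) j = g (x j) := rfl

/-- Deform `j` to `max j i` if `i` is the last vertex, to `min j i` otherwise. The final map misses
vertex `0`, respectively the last vertex, which differs from `i`. Every stage sends a vertex to
itself or to `i`, so a face omitting some `l ≠ i` still omits `l`. -/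
lemma horn_isAbsorbing {n : ℕ} (i : Fin (n + 2)) :
    ∃ k, (horn.{u} (n + 1) i).IsAbsorbing k := by
  by_cases hi : i = Fin.last _
  · refine ⟨1, stdSimplexHomotopy OrderHom.id ⟨fun j ↦ max j i, fun a b h ↦ by
      dsimp; exact max_le_max_right _ h⟩ (fun j ↦ le_max_left _ _), ?_, ?_⟩
    · ext ⟨⟨m⟩⟩ x : 4
      refine stdSimplex.ext _ _ fun j ↦ ?_
      exact cylinderEnd_zero_stdSimplexHomotopy_app_apply _ _ _ x j
    · rintro ⟨⟨m⟩⟩ ⟨x, t⟩ h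
      replace h := Subcomplex.mk_mem_unionProd_iff.1 h
      refine (mem_horn_iff_notMem_range _ _).2 ?_
      rcases h with h | h
      · refine ⟨0, by rw [hi]; exact Fin.last_pos.ne, ?_⟩
        rintro ⟨j, hj⟩
        have := (stdSimplexHomotopy_app_apply _ _ _ x t j).symm.trans hj
        rw [(mem_horn_one_iff _ _).1 h j, if_neg (by decide)] at this
        have h' : i ≤ 0 := this ▸ le_max_right (x j) i
        rw [hi] at h'
        exact absurd h' (by simp)
      · obtain ⟨l, hl, h⟩ := (mem_horn_iff_notMem_range _ _).1 h
        refine ⟨l, hl, ?_⟩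
        rintro ⟨j, hj⟩
        have := (stdSimplexHomotopy_app_apply _ _ _ x t j).symm.trans hj
        split_ifs at this
        · exact h ⟨j, this⟩
        · rcases max_choice (x j) i with h' | h'
          · exact h ⟨j, h'.symm.trans this⟩
          · exact hl (this.symm.trans h')
  · refine ⟨0, stdSimplexHomotopy ⟨fun j ↦ min j i, fun a b h ↦ by
      dsimp; exact min_le_min_right _ h⟩ OrderHom.id (fun j ↦ min_le_left _ _), ?_, ?_⟩
    · ext ⟨⟨m⟩⟩ x : 4
      refine stdSimplex.ext _ _ fun j ↦ ?_
      exact cylinderEnd_one_stdSimplexHomotopy_app_apply _ _ _ x j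
    · rintro ⟨⟨m⟩⟩ ⟨x, t⟩ h
      replace h := Subcomplex.mk_mem_unionProd_iff.1 h
      refine (mem_horn_iff_notMem_range _ _).2 ?_
      rcases h with h | h
      · refine ⟨Fin.last _, fun h ↦ hi h.symm, ?_⟩
        rintro ⟨j, hj⟩
        have := (stdSimplexHomotopy_app_apply _ _ _ x t j).symm.trans hj
        rw [(mem_horn_one_iff _ _).1 h j, if_pos rfl] at this
        have h' : Fin.last _ ≤ i := this ▸ min_le_right (x j) i
        exact hi (Fin.last_le_iff.1 h')
      · obtain ⟨l, hl, h⟩ := (mem_horn_iff_notMem_range _ _).1 h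
        refine ⟨l, hl, ?_⟩
        rintro ⟨j, hj⟩
        have := (stdSimplexHomotopy_app_apply _ _ _ x t j).symm.trans hj
        split_ifs at this
        · rcases min_choice (x j) i with h' | h'
          · exact h ⟨j, h'.symm.trans this⟩
          · exact hl (this.symm.trans h')
        · exact h ⟨j, this⟩

lemma anodyneExtensions_preimage_horn_ι {E : SSet.{u}} {n : ℕ} (i : Fin (n + 2))
    (p : E ⟶ Δ[n + 1]) [Fibration p] : anodyneExtensions ((horn (n + 1) i).preimage p).ι := by
  obtain ⟨k, hk⟩ := horn_isAbsorbing.{u} i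
  exact (hk.preimage p).anodyneExtensions

end SSet

/-! ### Dependent products along a map of simplicial sets -/

namespace SSet

open Simplicial Opposite Limits
open scoped modelCategoryQuillen

section

variable {P X Y Z : SSet.{u}} {fst : P ⟶ X} {snd : P ⟶ Y} {f : X ⟶ Z} {g : Y ⟶ Z}

lemma exists_of_isPullback (sq : IsPullback fst snd f g) {m : SimplexCategoryᵒᵖ}
    (x : X.obj m) (y : Y.obj m) (h : f.app m x = g.app m y) :
    ∃ z : P.obj m, fst.app m z = x ∧ snd.app m z = y :=
  Types.exists_of_isPullback (sq.map ((evaluation _ _).obj m)) x y h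

lemma ext_of_isPullback (sq : IsPullback fst snd f g) {m : SimplexCategoryᵒᵖ}
    {z z' : P.obj m} (h₁ : fst.app m z = fst.app m z') (h₂ : snd.app m z = snd.app m z') :
    z = z' :=
  Types.ext_of_isPullback (sq.map ((evaluation _ _).obj m)) h₁ h₂

/-- The simplex of a pullback given by a pair of compatible simplices. -/
noncomputable def pullbackMk (sq : IsPullback fst snd f g) {m : SimplexCategoryᵒᵖ}
    (x : X.obj m) (y : Y.obj m) (h : f.app m x = g.app m y) : P.obj m :=
  (exists_of_isPullback sq x y h).choose

@[simp]
lemma fst_pullbackMk (sq : IsPullback fst snd f g) {m : SimplexCategoryᵒᵖ}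
    (x : X.obj m) (y : Y.obj m) (h : f.app m x = g.app m y) :
    fst.app m (pullbackMk sq x y h) = x :=
  (exists_of_isPullback sq x y h).choose_spec.1

@[simp]
lemma snd_pullbackMk (sq : IsPullback fst snd f g) {m : SimplexCategoryᵒᵖ}
    (x : X.obj m) (y : Y.obj m) (h : f.app m x = g.app m y) :
    snd.app m (pullbackMk sq x y h) = y :=
  (exists_of_isPullback sq x y h).choose_spec.2

lemma condition_apply (sq : IsPullback fst snd f g) {m : SimplexCategoryᵒᵖ} (z : P.obj m) :
    f.app m (fst.app m z) = g.app m (snd.app m z) :=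
  ConcreteCategory.congr_hom (NatTrans.congr_app sq.w m) z

lemma map_pullbackMk (sq : IsPullback fst snd f g) {m m' : SimplexCategoryᵒᵖ} (φ : m ⟶ m')
    (x : X.obj m) (y : Y.obj m) (h : f.app m x = g.app m y) :
    P.map φ (pullbackMk sq x y h) = pullbackMk sq (X.map φ x) (Y.map φ y)
      (by rw [NatTrans.naturality_apply, h, NatTrans.naturality_apply]) := by
  refine ext_of_isPullback sq ?_ ?_
  · rw [NatTrans.naturality_apply, fst_pullbackMk, fst_pullbackMk]
  · rw [NatTrans.naturality_apply, snd_pullbackMk, snd_pullbackMk]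

lemma pullbackMk_congr (sq : IsPullback fst snd f g) {m : SimplexCategoryᵒᵖ}
    {x x' : X.obj m} {y y' : Y.obj m} (hx : x = x') (hy : y = y') (h : f.app m x = g.app m y)
    (h' : f.app m x' = g.app m y') : pullbackMk sq x y h = pullbackMk sq x' y' h' := by
  subst hx hy
  rfl

lemma pullbackMk_eq (sq : IsPullback fst snd f g) {m : SimplexCategoryᵒᵖ}
    {x : X.obj m} {y : Y.obj m} {z : P.obj m} (hx : x = fst.app m z) (hy : y = snd.app m z)
    (h : f.app m x = g.app m y) : pullbackMk sq x y h = z :=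
  ext_of_isPullback sq (by rw [fst_pullbackMk, hx]) (by rw [snd_pullbackMk, hy])

end

variable {E B X : SSet.{u}}

/-- The simplices of the dependent product of `q : X ⟶ E` along `p : E ⟶ B`: a simplex `b` of `B`
together with a section of `q` over the fiber product of `b` and `p`. -/
structure DepProdObj (p : E ⟶ B) (q : X ⟶ E) (m : SimplexCategoryᵒᵖ) where
  /-- the underlying simplex of the base -/
  base : B.obj m
  /-- the section -/
  sec {m' : SimplexCategoryᵒᵖ} (φ : m ⟶ m') (e : E.obj m') (h : p.app m' e = B.map φ base) :
    X.obj m'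
  app_sec {m' : SimplexCategoryᵒᵖ} (φ : m ⟶ m') (e : E.obj m') (h : p.app m' e = B.map φ base) :
    q.app m' (sec φ e h) = e
  map_sec {m' m'' : SimplexCategoryᵒᵖ} (φ : m ⟶ m') (ψ : m' ⟶ m'') (e : E.obj m')
    (h : p.app m' e = B.map φ base) (h' : p.app m'' (E.map ψ e) = B.map (φ ≫ ψ) base) :
    X.map ψ (sec φ e h) = sec (φ ≫ ψ) (E.map ψ e) h'

namespace DepProdObj

variable {p : E ⟶ B} {q : X ⟶ E}

lemma ext' {m : SimplexCategoryᵒᵖ} {s t : DepProdObj p q m} (h : s.base = t.base)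
    (h' : ∀ {m' : SimplexCategoryᵒᵖ} (φ : m ⟶ m') (e : E.obj m')
      (hs : p.app m' e = B.map φ s.base) (ht : p.app m' e = B.map φ t.base),
      s.sec φ e hs = t.sec φ e ht) : s = t := by
  obtain ⟨b, s, _, _⟩ := s
  obtain ⟨b', t, _, _⟩ := t
  obtain rfl : b = b' := h
  obtain rfl : @s = @t := by
    funext m' φ e he
    exact h' φ e he he
  rfl

lemma sec_congr {m : SimplexCategoryᵒᵖ} {s t : DepProdObj p q m} (h : s = t)
    {m' : SimplexCategoryᵒᵖ} {φ ψ : m ⟶ m'} (hφ : φ = ψ) {e e' : E.obj m'} (he : e = e')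
    (hs : p.app m' e = B.map φ s.base) (ht : p.app m' e' = B.map ψ t.base) :
    s.sec φ e hs = t.sec ψ e' ht := by
  subst h hφ he
  rfl

/-- The functoriality of the simplices of the dependent product. -/
def map {m n : SimplexCategoryᵒᵖ} (θ : m ⟶ n) (s : DepProdObj p q m) : DepProdObj p q n where
  base := B.map θ s.base
  sec φ e h := s.sec (θ ≫ φ) e (by rw [h, Functor.map_comp_apply])
  app_sec _ _ _ := s.app_sec _ _ _
  map_sec φ ψ e h h' := (s.map_sec (θ ≫ φ) ψ e _ (by
    simp only [h', Functor.map_comp_apply])).trans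
      (sec_congr rfl (Category.assoc _ _ _) rfl _ _)

end DepProdObj

/-- The dependent product of `q : X ⟶ E` along `p : E ⟶ B`. -/
def depProd (p : E ⟶ B) (q : X ⟶ E) : SSet.{u} where
  obj m := DepProdObj p q m
  map θ := ↾(DepProdObj.map θ)
  map_id m := by
    ext s
    exact DepProdObj.ext' (show B.map (𝟙 m) s.base = s.base from Functor.map_id_apply B _ _)
      (fun φ e _ _ ↦ DepProdObj.sec_congr rfl (Category.id_comp _) rfl _ _)
  map_comp θ θ' := by
    ext s
    exact DepProdObj.ext' (show B.map (θ ≫ θ') s.base = B.map θ' (B.map θ s.base) from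
        Functor.map_comp_apply B _ _ _)
      (fun φ e _ _ ↦ DepProdObj.sec_congr rfl (Category.assoc _ _ _) rfl _ _)

/-- The projection of the dependent product to the base. -/
def depProdπ (p : E ⟶ B) (q : X ⟶ E) : depProd p q ⟶ B where
  app _ := ↾DepProdObj.base
  naturality _ _ _ := rfl

section

variable {p : E ⟶ B} {q : X ⟶ E} {L L' : SSet.{u}} {ℓ : L ⟶ B} {fst : L' ⟶ L} {snd : L' ⟶ E}
  (sq : IsPullback fst snd ℓ p)

/-- The morphism to the dependent product corresponding to a morphism from a fiber product. -/
noncomputable def toDepProd (s : L' ⟶ X) (hs : s ≫ q = snd) : L ⟶ depProd p q where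
  app m := ↾fun l ↦
    { base := ℓ.app m l
      sec φ e h := s.app _ (pullbackMk sq (L.map φ l) e (by rw [h, NatTrans.naturality_apply]))
      app_sec φ e h := by
        refine (ConcreteCategory.congr_hom (NatTrans.congr_app hs _) _).trans ?_
        simp
      map_sec φ ψ e h h' := by
        rw [← NatTrans.naturality_apply, map_pullbackMk]
        exact congr_arg (s.app _)
          (pullbackMk_congr sq (Functor.map_comp_apply L φ ψ l).symm rfl _ _) }
  naturality m n θ := by
    ext l
    exact DepProdObj.ext' (show ℓ.app n (L.map θ l) = B.map θ (ℓ.app m l) from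
        NatTrans.naturality_apply ℓ θ l) (fun φ e h h' ↦ congr_arg (s.app _)
      (pullbackMk_congr sq (Functor.map_comp_apply L θ φ l).symm rfl _ _))

lemma toDepProd_π (s : L' ⟶ X) (hs : s ≫ q = snd) :
    toDepProd sq s hs ≫ depProdπ p q = ℓ := rfl

include sq in
lemma ofDepProd_aux (b : L ⟶ depProd p q) (hb : b ≫ depProdπ p q = ℓ) {m : SimplexCategoryᵒᵖ}
    (z : L'.obj m) :
    p.app m (snd.app m z) = B.map (𝟙 _) (DepProdObj.base (b.app m (fst.app m z))) := by
  rw [Functor.map_id_apply, ← condition_apply sq, ← hb]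
  rfl

/-- The morphism from a fiber product corresponding to a morphism to the dependent product. -/
def ofDepProd (b : L ⟶ depProd p q) (hb : b ≫ depProdπ p q = ℓ) : L' ⟶ X where
  app m := ↾fun z ↦ DepProdObj.sec (b.app m (fst.app m z)) (𝟙 _) (snd.app m z)
    (ofDepProd_aux sq b hb z)
  naturality m n θ := by
    ext z
    have h₁ : b.app n (fst.app n (L'.map θ z)) = DepProdObj.map θ (b.app m (fst.app m z)) := by
      rw [NatTrans.naturality_apply, NatTrans.naturality_apply]; rfl
    have h₂ : p.app n (E.map θ (snd.app m z)) =
        B.map θ (DepProdObj.base (b.app m (fst.app m z))) := by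
      rw [NatTrans.naturality_apply, ofDepProd_aux sq b hb z, Functor.map_id_apply]
    refine (DepProdObj.sec_congr h₁ rfl (NatTrans.naturality_apply snd θ z) _
      (by rw [Functor.map_id_apply]; exact h₂)).trans ?_
    refine (DepProdObj.sec_congr (s := b.app m (fst.app m z)) (ψ := 𝟙 _ ≫ θ) rfl
      ((Category.comp_id _).trans (Category.id_comp _).symm) rfl _
      (by rw [Category.id_comp]; exact h₂)).trans ?_
    exact (DepProdObj.map_sec _ (𝟙 _) θ _ _ _).symm

lemma ofDepProd_comp (b : L ⟶ depProd p q) (hb : b ≫ depProdπ p q = ℓ) :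
    ofDepProd sq b hb ≫ q = snd := by
  ext m z
  exact DepProdObj.app_sec _ _ _ _

lemma toDepProd_ofDepProd (b : L ⟶ depProd p q) (hb : b ≫ depProdπ p q = ℓ) :
    toDepProd sq (ofDepProd sq b hb) (ofDepProd_comp sq b hb) = b := by
  ext m l
  refine DepProdObj.ext' (show ℓ.app m l = (b ≫ depProdπ p q).app m l by rw [hb])
    (fun {n} φ e h h' ↦ ?_)
  have h₁ : b.app n (fst.app n (pullbackMk sq (L.map φ l) e
      (by rw [h, NatTrans.naturality_apply]; rfl))) = DepProdObj.map φ (b.app m l) := by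
    rw [fst_pullbackMk, NatTrans.naturality_apply]; rfl
  exact (DepProdObj.sec_congr h₁ rfl (snd_pullbackMk _ _ _ _) _
      (by rw [Functor.map_id_apply]; exact h')).trans
    (DepProdObj.sec_congr rfl (Category.comp_id _) rfl _ _)

lemma ofDepProd_toDepProd (s : L' ⟶ X) (hs : s ≫ q = snd) :
    ofDepProd sq (toDepProd sq s hs) (toDepProd_π sq s hs) = s := by
  ext m z
  exact congr_arg (s.app m) (pullbackMk_eq sq
    (show L.map (𝟙 m) (fst.app m z) = _ from Functor.map_id_apply L _ _) rfl _)

variable {K K' : SSet.{u}} {j : K ⟶ L} {fst' : K' ⟶ K} {j' : K' ⟶ L'}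
  (sq' : IsPullback fst' j' j fst)

/-- Naturality in `L` of the transposition; with it, lifting squares can be transposed. -/
lemma comp_toDepProd (s : L' ⟶ X) (hs : s ≫ q = snd) :
    j ≫ toDepProd sq s hs =
      toDepProd (sq'.paste_vert sq) (j' ≫ s) (by rw [Category.assoc, hs]) := by
  ext m k
  refine DepProdObj.ext' rfl (fun {n} φ e h h' ↦ ?_)
  refine congr_arg (s.app n) (pullbackMk_eq sq ?_ ?_ _)
  · refine (NatTrans.naturality_apply j φ k).symm.trans (Eq.trans ?_ (condition_apply sq' _))
    exact congr_arg (j.app n) (fst_pullbackMk (sq'.paste_vert sq) _ _ _).symm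
  · exact (snd_pullbackMk (sq'.paste_vert sq) _ _ _).symm

lemma comp_ofDepProd (b : L ⟶ depProd p q) (hb : b ≫ depProdπ p q = ℓ) :
    j' ≫ ofDepProd sq b hb =
      ofDepProd (sq'.paste_vert sq) (j ≫ b) (by rw [Category.assoc, hb]) := by
  ext m z
  exact DepProdObj.sec_congr (congr_arg (b.app m) (condition_apply sq' z).symm) rfl rfl _ _

end

/-! ### Base change of anodyne extensions along Kan fibrations -/

lemma isPullback_preimage {E B : SSet.{u}} (A : B.Subcomplex) (p : E ⟶ B) :
    IsPullback (A.fromPreimage p) (A.preimage p).ι A.ι p where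
  w := rfl
  isLimit' := ⟨PullbackCone.IsLimit.mk _
    (fun s ↦ Subcomplex.lift s.snd (by
      rintro m _ ⟨x, rfl⟩
      have := ConcreteCategory.congr_hom (NatTrans.congr_app s.condition m) x
      change p.app m (s.snd.app m x) ∈ A.obj m
      exact this ▸ (s.fst.app m x).2))
    (fun s ↦ by rw [← cancel_mono A.ι]; exact s.condition.symm)
    (fun s ↦ rfl)
    (fun s t _ h ↦ by rw [← cancel_mono (A.preimage p).ι]; exact h)⟩

/-- A lifting problem of a horn inclusion against `depProdπ p q` transposes to one of its pullback
along `p` against `q`. -/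
lemma fibration_depProdπ (p : E ⟶ B) (q : X ⟶ E) [Fibration p] [Fibration q] :
    Fibration (depProdπ p q) := by
  rw [fibration_iff]
  intro _ _ _ h
  simp only [modelCategoryQuillen.J, MorphismProperty.iSup_iff] at h
  obtain ⟨n, ⟨i⟩⟩ := h
  refine ⟨fun {a ℓ} sq ↦ ?_⟩
  have hp : Fibration (pullback.fst ℓ p) := by
    rw [modelCategoryQuillen.fibration_iff]
    exact MorphismProperty.of_isPullback (IsPullback.of_hasPullback ℓ p).flip
      ((modelCategoryQuillen.fibration_iff p).1 inferInstance)
  have hL := IsPullback.of_hasPullback ℓ p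
  have hK := isPullback_preimage (horn (n + 1) i) (pullback.fst ℓ p)
  have := anodyneExtensions_preimage_horn_ι i (pullback.fst ℓ p) q
    (by rwa [← HomotopicalAlgebra.fibration_iff])
  have hKL := hK.paste_vert hL
  have sq₂ : CommSq (ofDepProd hKL a sq.w) ((horn (n + 1) i).preimage (pullback.fst ℓ p)).ι q
    (pullback.snd ℓ p) := ⟨ofDepProd_comp hKL a sq.w⟩
  refine ⟨⟨⟨toDepProd hL sq₂.lift sq₂.fac_right, ?_, rfl⟩⟩⟩
  rw [comp_toDepProd hL hK]
  simp only [sq₂.fac_left]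
  exact toDepProd_ofDepProd _ _ _

lemma anodyneExtensions.of_isPullback {A A' : SSet.{u}} {i : A ⟶ B} {i' : A' ⟶ E} {r : A' ⟶ A}
    {p : E ⟶ B} (sq : IsPullback r i' i p) [Fibration p] (hi : anodyneExtensions i) :
    anodyneExtensions i' := by
  intro X Y q hq
  refine ⟨fun {u v} sq₁ ↦ ?_⟩
  have hq' : Fibration (pullback.snd q v) := by
    rw [modelCategoryQuillen.fibration_iff]
    exact MorphismProperty.of_isPullback (IsPullback.of_hasPullback q v) hq
  -- Replacing `q` by its base change along `v` puts the problem over `E`, where it can be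
  -- transposed.
  let u' : A' ⟶ pullback q v := pullback.lift u i' sq₁.w
  have hu' : u' ≫ pullback.snd q v = i' := pullback.lift_snd _ _ _
  have hE : IsPullback p (𝟙 E) (𝟙 B) p := .of_id_snd
  have hA := sq.paste_vert hE
  have := hi (depProdπ p (pullback.snd q v)) (by
    rw [← HomotopicalAlgebra.fibration_iff]
    exact fibration_depProdπ _ _)
  have sq₂ : CommSq (toDepProd hA u' (hu'.trans (Category.comp_id _).symm)) i
    (depProdπ p (pullback.snd q v)) (𝟙 B) := ⟨rfl⟩
  refine ⟨⟨⟨ofDepProd hE sq₂.lift sq₂.fac_right ≫ pullback.fst q v, ?_, ?_⟩⟩⟩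
  · rw [← Category.assoc, comp_ofDepProd hE sq]
    simp only [sq₂.fac_left]
    rw [ofDepProd_toDepProd]
    exact pullback.lift_fst _ _ _
  · rw [Category.assoc, pullback.condition, ← Category.assoc, ofDepProd_comp, Category.id_comp]

end SSet

/-! ### Stalks and right properness -/

section

open Limits

/-- By finite presentability a lifting square already exists, and commutes, at some stage of the
filtered diagram. -/
lemma CategoryTheory.HasLiftingProperty.of_isColimit_of_isFiltered {D : Type u} [Category.{v} D]
    {K : Type w} [SmallCategory K] [IsFiltered K] {F G : K ⥤ D} (α : F ⟶ G)
    {c : Cocone F} {d : Cocone G} (hc : IsColimit c) (hd : IsColimit d) (φ : c.pt ⟶ d.pt)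
    (hφ : ∀ k, c.ι.app k ≫ φ = α.app k ≫ d.ι.app k) {A B : D} (i : A ⟶ B)
    [IsFinitelyPresentable.{w} A] [IsFinitelyPresentable.{w} B]
    [∀ k, HasLiftingProperty i (α.app k)] : HasLiftingProperty i φ where
  sq_hasLift {a b} sq := by
    obtain ⟨k, a, rfl⟩ := IsFinitelyPresentable.exists_hom_of_isColimit hc a
    obtain ⟨l, b, rfl⟩ := IsFinitelyPresentable.exists_hom_of_isColimit hd b
    obtain ⟨m, s, t, h⟩ := IsFinitelyPresentable.exists_eq_of_isColimit hd
      (a ≫ α.app k) (i ≫ b) (by simpa [hφ] using sq.w)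
    have sq' : CommSq (a ≫ F.map s) i (α.app m) (b ≫ G.map t) :=
      ⟨by simpa using h⟩
    exact ⟨⟨⟨sq'.lift ≫ c.ι.app m, by simp [sq'.fac_left_assoc],
      by simp [hφ, sq'.fac_right_assoc]⟩⟩⟩

end

namespace SimplicialPresheaf

open Limits
open scoped SSet.modelCategoryQuillen

variable {C : Type u} [Category.{v} C] {J : GrothendieckTopology C}

lemma kanFibrations_presheafFiber_map [LocallySmall.{w} C] (x : GrothendieckTopology.Point.{w} J)
    {X Y : Cᵒᵖ ⥤ SSet.{w}} {f : X ⟶ Y} (hf : projectiveFibrations.{w} C f) :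
    kanFibrations (x.presheafFiber.map f) := by
  intro _ _ _ h
  simp only [SSet.modelCategoryQuillen.J, MorphismProperty.iSup_iff] at h
  obtain ⟨n, ⟨i⟩⟩ := h
  -- The category of elements need not be `w`-small, so the colimit is taken over a small filtered
  -- category final in it.
  let π := FinallySmall.fromFilteredFinalModel.{w} x.fiber.Elementsᵒᵖ
  have (k : FinallySmall.FilteredFinalModel.{w} x.fiber.Elementsᵒᵖ) : HasLiftingProperty (SSet.horn (n + 1) i).ι
      ((Functor.whiskerLeft π (Functor.whiskerLeft
        (CategoryOfElements.π x.fiber).op f)).app k) :=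
    hf _ _ (SSet.modelCategoryQuillen.horn_ι_mem_J _ _)
  have hc {Q : Cᵒᵖ ⥤ SSet.{w}} : IsColimit ((x.presheafFiberCocone Q).whisker π) :=
    (Functor.Final.isColimitWhiskerEquiv π _).symm (x.isColimitPresheafFiberCocone Q)
  exact HasLiftingProperty.of_isColimit_of_isFiltered
    (Functor.whiskerLeft π (Functor.whiskerLeft (CategoryOfElements.π x.fiber).op f))
    hc hc (x.presheafFiber.map f) (fun _ ↦ x.toPresheafFiber_naturality f _ _) _

lemma kanQuillenWeakEquivalences_of_isPullback {P X Y Z : SSet.{w}} {f' : P ⟶ X} {g' : P ⟶ Y}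
    {f : X ⟶ Z} {g : Y ⟶ Z} (sq : IsPullback f' g' f g) (hf : kanFibrations f)
    (hg : kanQuillenWeakEquivalences g) : kanQuillenWeakEquivalences f' := by
  obtain ⟨E, i, p, hi, hp, rfl⟩ := hg
  have hq := IsPullback.of_hasPullback f p
  -- The base change of `i` is along `pullback.snd f p`, itself a base change of the fibration `f`.
  have sq' : IsPullback (hq.lift f' (g' ≫ i) (by rw [sq.w, Category.assoc])) g'
      (pullback.snd f p) i :=
    .of_right (by rwa [hq.lift_fst]) (hq.lift_snd _ _ _) hq
  have : Fibration (pullback.snd f p) := by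
    rw [SSet.modelCategoryQuillen.fibration_iff]
    exact MorphismProperty.of_isPullback hq hf
  exact ⟨_, _, pullback.fst f p, SSet.anodyneExtensions.of_isPullback sq'.flip hi,
    MorphismProperty.of_isPullback hq.flip hp, hq.lift_fst _ _ _⟩

end SimplicialPresheaf

theorem lemma2p3 {C : Type u} [Category.{v} C] [EssentiallySmall.{w} C]
    (J : GrothendieckTopology C) [GrothendieckTopology.HasEnoughPoints.{w} J]
    {P X Y Z : Cᵒᵖ ⥤ SSet.{w}} {f' : P ⟶ X} {g' : P ⟶ Y} {f : X ⟶ Z} {g : Y ⟶ Z}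
    (sq : IsPullback f' g' f g)
    (hf : SimplicialPresheaf.projectiveFibrations.{w} C f)
    (hg : SimplicialPresheaf.localWeakEquivalences.{w} J g) :
    SimplicialPresheaf.localWeakEquivalences.{w} J f' := by
  intro x
  -- Exactness of filtered colimits lets the stalk functor preserve the pullback square.
  have : AB5OfSize.{w, w} SSet.{w} :=
    ⟨fun K _ _ ↦ inferInstanceAs (HasExactColimitsOfShape K (SimplexCategoryᵒᵖ ⥤ Type w))⟩
  exact SimplicialPresheaf.kanQuillenWeakEquivalences_of_isPullback (sq.map x.presheafFiber)
    (SimplicialPresheaf.kanFibrations_presheafFiber_map x hf) (hg x)
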